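/- Let $K\subset\mathbb{R}^n$ be a centrally symmetric convex body (compact, convex, with non-empty interior, $K=-K$), and write $B_2^n$ and $S^{n-1}$ for the closed Euclidean unit ball and the unit sphere. An ellipsoid is a set of the form $TB_2^n+c$ with $T\in GL_n(\mathbb{R})$ and $c\in\mathbb{R}^n$. Let $\mathrm{vol}_{n-1}$ denote the $(n-1)$-dimensional surface area measure, that is, the Hausdorff measure of dimension $n-1$ normalized to agree with Lebesgue measure on $\mathbb{R}^{n-1}$. Assume that - $\mathrm{vol}_{n-1}(\partial K\cap\partial\mathcal{E})=0$ for all but finitely many ellipsoids $\mathcal{E}\subset\mathbb{R}^n$, - $\mathrm{vol}_{n-1}(\partial K\cap S^{n-1})=0$ and $\mathrm{vol}_{n-1}(K\cap S^{n-1})>0$, - $K$ is in maximal intersection position of radius $1$, that is, $\mathrm{vol}_n(K\cap B_2^n)\ge \mathrm{vol}_n(K\cap\mathcal{E})$ for every ellipsoid $\mathcal{E}$ with $\mathrm{vol}_n(\mathcal{E})=\mathrm{vol}_n(B_2^n)$. Let $A\in M_n(\mathbb{R})$ with $\operatorname{tr}A=0$, and let $V(t)=\mathrm{vol}_n(K\cap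 e^{tA}B_2^n)$ for $t\in\mathbb{R}$. Then $V$ is differentiable at $t=0$, the function $x\mapsto\langle x,Ax\rangle$ is integrable on $S^{n-1}\cap K$ with respect to $S=\mathrm{vol}_{n-1}$, and $$V'(0)=\int_{S^{n-1}\cap K}\langle x,Ax\rangle\,dS(x).$$ -/

import Mathlib

open MeasureTheory Metric Set

/-- A (nondegenerate, not necessarily centred) ellipsoid in `ℝⁿ`: the image `T B₂ⁿ + c` of the
closed Euclidean unit ball under an invertible affine map. -/
def IsEllipsoid {n : ℕ} (E : Set (EuclideanSpace ℝ (Fin n))) : Prop :=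
  ∃ (T : EuclideanSpace ℝ (Fin n) ≃ₗ[ℝ] EuclideanSpace ℝ (Fin n))
    (c : EuclideanSpace ℝ (Fin n)),
    E = (fun x => T x + c) '' closedBall (0 : EuclideanSpace ℝ (Fin n)) 1

/-- `E` is an ellipsoid of volume `rⁿ κₙ`, where `κₙ` is the volume of the unit ball. -/
def IsEllipsoidOfRadius {n : ℕ} (r : ℝ) (E : Set (EuclideanSpace ℝ (Fin n))) : Prop :=
  IsEllipsoid E ∧
    volume E = ENNReal.ofReal (r ^ n) * volume (closedBall (0 : EuclideanSpace ℝ (Fin n)) 1)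

/-- `E` is a maximum intersection ellipsoid of radius `r` for `K`: it is an ellipsoid of volume
`rⁿ κₙ`, and no ellipsoid of that volume meets `K` in a larger volume. -/
def IsMaxIntersectionEllipsoid {n : ℕ} (K : Set (EuclideanSpace ℝ (Fin n))) (r : ℝ)
    (E : Set (EuclideanSpace ℝ (Fin n))) : Prop :=
  IsEllipsoidOfRadius r E ∧
    ∀ E' : Set (EuclideanSpace ℝ (Fin n)), IsEllipsoidOfRadius r E' →
      volume (K ∩ E') ≤ volume (K ∩ E)

/-- `K` is in maximal intersection position of radius `r > 0`: the ball `r B₂ⁿ` is a maximum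
intersection ellipsoid of radius `r` for `K`. -/
def IsMaxIntersectionPosition {n : ℕ} (K : Set (EuclideanSpace ℝ (Fin n))) (r : ℝ) : Prop :=
  IsMaxIntersectionEllipsoid K r (closedBall (0 : EuclideanSpace ℝ (Fin n)) r)

/-- The `(n-1)`-dimensional volume (surface area measure) on `ℝⁿ`: the Hausdorff measure of
dimension `n - 1`, normalized so as to agree with Lebesgue measure on `ℝⁿ⁻¹`.
(For `n = 0` the truncated subtraction makes this the counting measure; spheres are empty there.) -/
noncomputable def surfaceVolume (n : ℕ) : Measure (EuclideanSpace ℝ (Fin n)) :=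
  μHE[n - 1]

/-- The set `e^{tA} B₂ⁿ`. -/
noncomputable def expBall {n : ℕ} (A : Matrix (Fin n) (Fin n) ℝ) (t : ℝ) :
    Set (EuclideanSpace ℝ (Fin n)) :=
  Matrix.toEuclideanLin (NormedSpace.exp (t • A)) '' closedBall 0 1

/-!
In polar coordinates, `K ∩ e^{tA} B` has volume `∫_θ ∫_0^{ρ_t(θ)} rⁿ⁻¹ 1_K(rθ) dr dσ(θ)`, where
`ρ_t(θ) = ‖e^{-tA} θ‖⁻¹` is the radial function of `e^{tA} B` and `σ` is the polar measure on the
sphere. If `θ ∉ ∂K`, then `r ↦ 1_K(rθ)` is constant near `r = 1`, so the inner integral has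
derivative `1_K(θ) ⟪θ, Aθ⟫` at `t = 0` (`hasDerivAt_integral_radialDensity`,
`hasDerivAt_inv_norm_exp_smul`). It is Lipschitz in `t` near `0`, uniformly in `θ`
(`exists_lipschitz_inv_norm_exp_smul`), and dominated convergence gives the derivative of the volume
(`hasDerivAt_volume_inter_exp_smul`).

The polar measure `σ(s) = n vol((0,1) • s)` has to be identified with the normalized Hausdorff
measure (`toSphere_eq_comap_euclideanHausdorffMeasure`). On a hyperplane at distance `1` from the
origin the two notions coincide, by the volume formula for cones (`finrank_mul_volume_Ioo_smul`).
A small spherical cap is carried to its tangent hyperplane by the gnomonic projection, which changes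
both quantities by factors close to `1` (`cap_comparison`). A countable cover by caps of radius `ε`
turns this into a global comparison (`measure_le_mul_of_locally`), and `ε → 0` gives equality.
-/

/-! ### The polar measure on the sphere is the Hausdorff measure -/

open scoped Pointwise ENNReal NNReal in
theorem euclideanHausdorffMeasure_image_le {X Y : Type*} [EMetricSpace X] [MeasurableSpace X]
    [BorelSpace X] [EMetricSpace Y] [MeasurableSpace Y] [BorelSpace Y] {f : X → Y} {s : Set X}
    {L : ℝ≥0} (hf : LipschitzOnWith L f s) (d : ℕ) :
    (μHE[d] : Measure Y) (f '' s) ≤ (L : ℝ≥0∞) ^ d * (μHE[d] : Measure X) s := by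
  simp only [Measure.euclideanHausdorffMeasure_def, Measure.smul_apply, ENNReal.smul_def,
    smul_eq_mul]
  have := hf.hausdorffMeasure_image_le (d := d) (by positivity)
  rw [ENNReal.rpow_natCast] at this
  calc _ ≤ _ := mul_le_mul_right this _
    _ = _ := by ring

section
variable {V : Type*} [NormedAddCommGroup V] [InnerProductSpace ℝ V]

open scoped Pointwise in
theorem Ioo_smul_eq_of_inner_eq_one {v : V} {F : Set V} (hF : ∀ x ∈ F, inner ℝ v x = 1) :
    Ioo (0 : ℝ) 1 • F = {x | inner ℝ v x ∈ Ioo (0 : ℝ) 1 ∧ (inner ℝ v x)⁻¹ • x ∈ F} := by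
  ext x
  constructor
  · rintro ⟨r, hr, y, hy, rfl⟩
    have h : inner ℝ v (r • y) = r := by rw [inner_smul_right, hF y hy, mul_one]
    simp only [mem_ofPred_eq, h]
    exact ⟨hr, by rwa [inv_smul_smul₀ hr.1.ne']⟩
  · rintro ⟨h, hx⟩
    exact ⟨_, h, _, hx, smul_inv_smul₀ h.1.ne' x⟩

open scoped Pointwise in
theorem smul_eq_Ioo_smul_inter_hyperplane {v : V} {F : Set V}
    (hF : ∀ x ∈ F, inner ℝ v x = 1) {h : ℝ} (hh : h ∈ Ioo (0 : ℝ) 1) :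
    Ioo (0 : ℝ) 1 • F ∩ {x | inner ℝ v x = h} = h • F := by
  rw [Ioo_smul_eq_of_inner_eq_one hF]
  ext x
  rw [mem_smul_set_iff_inv_smul_mem₀ hh.1.ne']
  constructor
  · rintro ⟨⟨_, h2⟩, rfl⟩
    exact h2
  · intro hx
    have h1 := hF _ hx
    rw [inner_smul_right, inv_mul_eq_one₀ hh.1.ne'] at h1
    simp only [mem_inter_iff, mem_ofPred_eq, ← h1, and_true]
    exact ⟨h1 ▸ hh, h1 ▸ hx⟩

/-- Radial projection onto the unit sphere is `1`-Lipschitz outside the open unit ball. -/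
theorem norm_inv_smul_sub_le {p q : V} (hp : 1 ≤ ‖p‖) (hq : 1 ≤ ‖q‖) :
    ‖‖p‖⁻¹ • p - ‖q‖⁻¹ • q‖ ≤ ‖p - q‖ := by
  have hp0 : (0 : ℝ) < ‖p‖ := by linarith
  have hq0 : (0 : ℝ) < ‖q‖ := by linarith
  refine le_of_sq_le_sq ?_ (norm_nonneg _)
  rw [norm_sub_sq_real, norm_sub_sq_real, norm_smul, norm_smul, inner_smul_left, inner_smul_right,
    norm_inv, norm_inv, norm_norm, norm_norm, inv_mul_cancel₀ hp0.ne', inv_mul_cancel₀ hq0.ne']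
  have hi : inner ℝ p q ≤ ‖p‖ * ‖q‖ := real_inner_le_norm p q
  simp only [conj_trivial]
  have : ‖p‖⁻¹ * (‖q‖⁻¹ * inner ℝ p q) = inner ℝ p q / (‖p‖ * ‖q‖) := by
    field_simp
  rw [this]
  have h1 : (0 : ℝ) < ‖p‖ * ‖q‖ := by positivity
  have h2 : 1 ≤ ‖p‖ * ‖q‖ := by nlinarith
  have h3 : (‖p‖ * ‖q‖ - inner ℝ p q) / (‖p‖ * ‖q‖) ≤ ‖p‖ * ‖q‖ - inner ℝ p q :=
    div_le_self (by linarith) h2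
  rw [sub_div, div_self h1.ne'] at h3
  nlinarith [sq_nonneg (‖p‖ - ‖q‖)]

theorem one_sub_le_inner_of_norm_sub_le {v x : V} {ε : ℝ} (hv : ‖v‖ = 1) (h : ‖x - v‖ ≤ ε) :
    1 - ε ≤ inner ℝ v x := by
  have h1 := (abs_le.1 (abs_real_inner_le_norm v (x - v))).1
  rw [inner_sub_right, real_inner_self_eq_norm_sq, hv] at h1
  linarith

/-- The gnomonic projection `x ↦ x / ⟪v, x⟫` is Lipschitz on the spherical cap of radius `ε`
around `v`, with a constant tending to `1` as `ε → 0`. -/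
theorem norm_inv_inner_smul_sub_le {v x y : V} {ε : ℝ} (hε : ε < 1) (hv : ‖v‖ = 1)
    (hx : ‖x‖ = 1) (hy : ‖y‖ = 1) (hxv : ‖x - v‖ ≤ ε) (hyv : ‖y - v‖ ≤ ε) :
    ‖(inner ℝ v x)⁻¹ • x - (inner ℝ v y)⁻¹ • y‖ ≤ ((1 - ε) ^ 2)⁻¹ * ‖x - y‖ := by
  have hc : 0 < 1 - ε := by linarith
  have h1 := one_sub_le_inner_of_norm_sub_le hv hxv
  have h2 := one_sub_le_inner_of_norm_sub_le hv hyv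
  have hε0 : 0 ≤ ε := (norm_nonneg _).trans hxv
  set a := inner ℝ v x with ha
  set b := inner ℝ v y with hb
  have ha0 : 0 < a := by linarith
  have hb0 : 0 < b := by linarith
  have hdec : a⁻¹ • x - b⁻¹ • y = a⁻¹ • (x - y) + (a⁻¹ * b⁻¹ * (b - a)) • y := by
    have : a⁻¹ * b⁻¹ * (b - a) = a⁻¹ - b⁻¹ := by field_simp
    rw [this, smul_sub, sub_smul]
    abel
  -- As `x + y ⟂ x - y`, the vector `v` may be replaced by `v - (x + y) / 2`, of norm at most `ε`.
  have hba : |b - a| ≤ ε * ‖x - y‖ := by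
    have horth : inner ℝ (x + y) (x - y) = (0 : ℝ) := by
      rw [real_inner_add_sub_eq_zero_iff, hx, hy]
    have e : b - a = inner ℝ ((1 / 2 : ℝ) • ((x - v) + (y - v))) (x - y) := by
      have : (1 / 2 : ℝ) • ((x - v) + (y - v)) = (1 / 2 : ℝ) • (x + y) - v := by module
      rw [this, inner_sub_left, inner_smul_left, horth, inner_sub_right, ha, hb]
      simp
    rw [e]
    refine (abs_real_inner_le_norm _ _).trans ?_
    gcongr
    rw [norm_smul]
    have := norm_add_le (x - v) (y - v)
    norm_num
    linarith
  rw [hdec]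
  have hai : a⁻¹ ≤ (1 - ε)⁻¹ := inv_anti₀ hc h1
  have hbi : b⁻¹ ≤ (1 - ε)⁻¹ := inv_anti₀ hc h2
  calc _ ≤ ‖a⁻¹ • (x - y)‖ + ‖(a⁻¹ * b⁻¹ * (b - a)) • y‖ := norm_add_le _ _
    _ = a⁻¹ * ‖x - y‖ + a⁻¹ * b⁻¹ * |b - a| := by
      rw [norm_smul, norm_smul, hy, Real.norm_eq_abs, Real.norm_eq_abs, abs_mul, abs_mul,
        abs_of_pos (inv_pos.2 ha0), abs_of_pos (inv_pos.2 hb0), mul_one]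
    _ ≤ (1 - ε)⁻¹ * ‖x - y‖ + (1 - ε)⁻¹ * (1 - ε)⁻¹ * (ε * ‖x - y‖) := by gcongr
    _ = _ := by field_simp; ring

variable [MeasurableSpace V] [BorelSpace V] [FiniteDimensional ℝ V]
open Module
open scoped Pointwise ENNReal NNReal

/-- The volume of the cone with apex `0` over a flat base `F` at height `1` is the `(n-1)`-volume
of `F` divided by `n`, by slicing parallel to `F`. -/
theorem finrank_mul_volume_Ioo_smul {v : V} (hv : ‖v‖ = 1) {F : Set V} (hFm : MeasurableSet F)
    (hF : ∀ x ∈ F, inner ℝ v x = 1) :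
    finrank ℝ V * volume (Ioo (0 : ℝ) 1 • F) = μHE[finrank ℝ V - 1] F := by
  have hv0 : v ≠ 0 := by rintro rfl; simp at hv
  have : Nontrivial V := ⟨v, 0, hv0⟩
  have hn : 0 < finrank ℝ V := finrank_pos
  have hm : MeasurableSet (Ioo (0 : ℝ) 1 • F) := by
    rw [Ioo_smul_eq_of_inner_eq_one hF]
    have h1 : Measurable fun x : V => inner ℝ v x := by fun_prop
    exact (h1 measurableSet_Ioo).inter ((h1.inv.smul measurable_id) hFm)
  rw [← InnerProductSpace.euclideanHausdorffMeasure_eq_volume,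
    EuclideanGeometry.euclideanHausdorffMeasure_eq_lintegral (0 : V) hv0 hm]
  have hplane : ∀ h : ℝ, (AffineSubspace.mk' (h • v +ᵥ (0 : V)) (ℝ ∙ v)ᗮ : Set V) =
      {x | inner ℝ v x = h} := by
    intro h
    ext x
    simp [AffineSubspace.mem_mk', Submodule.mem_orthogonal_singleton_iff_inner_right,
      inner_sub_right, inner_smul_right, hv, sub_eq_zero]
  have hint : ∀ h : ℝ, μHE[finrank ℝ V - 1]
      (Ioo (0 : ℝ) 1 • F ∩ AffineSubspace.mk' (h • v +ᵥ (0 : V)) (ℝ ∙ v)ᗮ) =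
      (Ioo (0 : ℝ) 1).indicator (fun h => ENNReal.ofReal (h ^ (finrank ℝ V - 1)) *
        μHE[finrank ℝ V - 1] F) h := by
    intro h
    rw [hplane]
    by_cases hh : h ∈ Ioo (0 : ℝ) 1
    · rw [smul_eq_Ioo_smul_inter_hyperplane hF hh, indicator_of_mem hh,
        Measure.euclideanHausdorffMeasure_smul₀ _ hh.1.ne', ENNReal.smul_def, smul_eq_mul,
        ENNReal.ofReal_pow hh.1.le]
      congr 1
      push_cast
      rw [← enorm_eq_nnnorm, Real.enorm_of_nonneg hh.1.le]
    · rw [indicator_of_notMem hh]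
      refine (congrArg _ ?_).trans measure_empty
      rw [Ioo_smul_eq_of_inner_eq_one hF]
      ext x
      simp only [mem_inter_iff, mem_ofPred_eq, mem_empty_iff_false, iff_false]
      rintro ⟨⟨h1, _⟩, rfl⟩
      exact hh h1
  simp_rw [hint]
  rw [lintegral_indicator measurableSet_Ioo, lintegral_mul_const _ (by fun_prop),
    ← ofReal_integral_eq_lintegral_ofReal, ← integral_Ioc_eq_integral_Ioo,
    ← intervalIntegral.integral_of_le zero_le_one, integral_pow]
  · rw [← ofReal_norm, hv, ENNReal.ofReal_one, one_mul, ← mul_assoc, ← ENNReal.ofReal_natCast,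
      ← ENNReal.ofReal_mul (by positivity)]
    rw [← Nat.cast_add_one, Nat.sub_add_cancel hn]
    simp [hn.ne']
  · exact (intervalIntegral.intervalIntegrable_pow _).1.mono_set Ioo_subset_Ioc_self
  · filter_upwards [ae_restrict_mem measurableSet_Ioo] with r hr
    exact pow_nonneg hr.1.le _

/-- On a spherical cap of radius `ε`, the Hausdorff measure and the cone measure
`s ↦ n * volume (Ioo 0 1 • s)` agree up to factors that tend to `1` as `ε → 0`. Both are compared
with the Hausdorff measure of the gnomonic projection of `s` to the tangent hyperplane
`⟪v, x⟫ = 1`, for which the two notions coincide. -/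
theorem cap_comparison {v : V} (hv : ‖v‖ = 1) {ε : ℝ} (hε : ε < 1) {s : Set V}
    (hs : MeasurableSet s) (hs1 : ∀ x ∈ s, ‖x‖ = 1) (hsv : ∀ x ∈ s, ‖x - v‖ ≤ ε) :
    μHE[finrank ℝ V - 1] s ≤ ENNReal.ofReal ((1 - ε)⁻¹ ^ finrank ℝ V) *
        (finrank ℝ V * volume (Ioo (0 : ℝ) 1 • s)) ∧
      finrank ℝ V * volume (Ioo (0 : ℝ) 1 • s) ≤
        ENNReal.ofReal (((1 - ε) ^ 2)⁻¹ ^ (finrank ℝ V - 1)) * μHE[finrank ℝ V - 1] s := by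
  have hc : 0 < 1 - ε := by linarith
  set G : V → V := fun x => (inner ℝ v x)⁻¹ • x with hG
  set N : V → V := fun x => ‖x‖⁻¹ • x with hN
  have hpos : ∀ x ∈ s, 1 - ε ≤ inner ℝ v x := fun x hx =>
    one_sub_le_inner_of_norm_sub_le hv (hsv x hx)
  have hNG : ∀ x ∈ s, N (G x) = x := by
    intro x hx
    have h0 : 0 < inner ℝ v x := hc.trans_le (hpos x hx)
    simp only [hN, hG, norm_smul, hs1 x hx, norm_inv, Real.norm_of_nonneg h0.le, mul_one, inv_inv]
    exact smul_inv_smul₀ h0.ne' x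
  have hGv : ∀ x ∈ s, inner ℝ v (G x) = 1 := by
    intro x hx
    have h0 : 0 < inner ℝ v x := hc.trans_le (hpos x hx)
    rw [hG, inner_smul_right, inv_mul_cancel₀ h0.ne']
  have hFv : ∀ y ∈ G '' s, inner ℝ v y = 1 := by
    rintro _ ⟨x, hx, rfl⟩; exact hGv x hx
  have hFnorm : ∀ y : V, inner ℝ v y = 1 → 1 ≤ ‖y‖ := by
    intro y hy
    have := real_inner_le_norm v y
    rwa [hy, hv, one_mul] at this
  have hFm : MeasurableSet (G '' s) := by
    have : G '' s = {y | inner ℝ v y = 1} ∩ N ⁻¹' s := by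
      ext y
      constructor
      · rintro ⟨x, hx, rfl⟩
        exact ⟨hGv x hx, by rw [mem_preimage, hNG x hx]; exact hx⟩
      · rintro ⟨h1 : inner ℝ v y = 1, h2⟩
        refine ⟨N y, h2, ?_⟩
        have h0 : ‖y‖ ≠ 0 := by linarith [hFnorm y h1]
        simp only [hG, hN, inner_smul_right, h1, mul_one, inv_inv]
        exact smul_inv_smul₀ h0 y
    rw [this]
    refine MeasurableSet.inter ?_ ?_
    · exact (measurable_const.inner measurable_id) (measurableSet_singleton (1 : ℝ))
    · exact (measurable_norm.inv.smul measurable_id) hs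
  have hcone := finrank_mul_volume_Ioo_smul hv hFm hFv
  have hNs : N '' (G '' s) = s := by
    rw [image_image]
    exact (image_congr hNG).trans (image_id' s)
  -- `s` is a `1`-Lipschitz image of `G '' s`, and the cone over `G '' s` lies in a dilate of the
  -- cone over `s`.
  constructor
  · have hlip : LipschitzOnWith 1 N (G '' s) := by
      refine LipschitzOnWith.of_dist_le_mul fun x hx y hy => ?_
      rw [dist_eq_norm, dist_eq_norm, NNReal.coe_one, one_mul]
      exact norm_inv_smul_sub_le (hFnorm x (hFv x hx)) (hFnorm y (hFv y hy))
    have h1 := euclideanHausdorffMeasure_image_le hlip (finrank ℝ V - 1)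
    rw [hNs, ENNReal.coe_one, one_pow, one_mul, ← hcone] at h1
    have hsub : Ioo (0 : ℝ) 1 • (G '' s) ⊆ (1 - ε)⁻¹ • (Ioo (0 : ℝ) 1 • s) := by
      rintro _ ⟨r, hr, _, ⟨x, hx, rfl⟩, rfl⟩
      have h0 : 0 < inner ℝ v x := hc.trans_le (hpos x hx)
      refine ⟨((1 - ε) * r * (inner ℝ v x)⁻¹) • x, ⟨_, ⟨?_, ?_⟩, x, hx, rfl⟩, ?_⟩
      · have := hr.1; positivity
      · rw [← div_eq_mul_inv, div_lt_one h0]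
        nlinarith [hr.1, hr.2, hpos x hx]
      · simp only [hG, smul_smul]
        congr 1
        field_simp
    have h2 := measure_mono (μ := volume) hsub
    rw [Measure.addHaar_smul, abs_of_pos (by positivity)] at h2
    calc _ ≤ _ := h1
      _ ≤ _ := mul_le_mul_right h2 _
      _ = _ := by ring
  -- `G` is almost `1`-Lipschitz, and the cone over `s` lies in the cone over `G '' s`.
  · have hlip : LipschitzOnWith (Real.toNNReal ((1 - ε) ^ 2)⁻¹) G s := by
      refine LipschitzOnWith.of_dist_le_mul fun x hx y hy => ?_
      rw [dist_eq_norm, dist_eq_norm, Real.coe_toNNReal _ (by positivity)]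
      exact norm_inv_inner_smul_sub_le hε hv (hs1 x hx) (hs1 y hy) (hsv x hx) (hsv y hy)
    have h1 := euclideanHausdorffMeasure_image_le hlip (finrank ℝ V - 1)
    rw [← hcone] at h1
    have hsub : Ioo (0 : ℝ) 1 • s ⊆ Ioo (0 : ℝ) 1 • (G '' s) := by
      rintro _ ⟨r, hr, x, hx, rfl⟩
      have h0 : 0 < inner ℝ v x := hc.trans_le (hpos x hx)
      have hle : inner ℝ v x ≤ 1 := by
        have := real_inner_le_norm v x
        rwa [hv, hs1 x hx, one_mul] at this
      refine ⟨r * inner ℝ v x, ⟨mul_pos hr.1 h0, ?_⟩, G x, mem_image_of_mem _ hx, ?_⟩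
      · nlinarith [hr.1, hr.2]
      · simp only [hG, smul_smul]
        congr 1
        field_simp
    calc _ ≤ _ := mul_le_mul_right (measure_mono hsub) _
      _ ≤ _ := h1
      _ = _ := by rw [ENNReal.ofReal_pow (by positivity), ENNReal.ofReal]
end

open scoped ENNReal in
/-- A comparison of two measures that holds near every point holds globally: split along a
countable cover made disjoint. -/
theorem measure_le_mul_of_locally {X : Type*} [TopologicalSpace X] [SecondCountableTopology X]
    [MeasurableSpace X] [OpensMeasurableSpace X] {μ ν : Measure X} {C : ℝ≥0∞} (U : X → Set X)
    (hUo : ∀ x, IsOpen (U x)) (hU : ∀ x, x ∈ U x)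
    (h : ∀ x, ∀ s, MeasurableSet s → s ⊆ U x → μ s ≤ C * ν s) {s : Set X} (hs : MeasurableSet s) :
    μ s ≤ C * ν s := by
  obtain ⟨T, hT, hcov⟩ := TopologicalSpace.countable_cover_nhds fun x => (hUo x).mem_nhds (hU x)
  rcases isEmpty_or_nonempty X with hX | hX
  · simp [Set.eq_empty_of_isEmpty s]
  have hTne : T.Nonempty := by
    by_contra hne
    rw [not_nonempty_iff_eq_empty] at hne
    exact empty_ne_univ (by simpa [hne] using hcov)
  obtain ⟨f, rfl⟩ := hT.exists_eq_range hTne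
  rw [biUnion_range] at hcov
  set D := disjointed fun i => U (f i) with hD
  have hDm : ∀ i, MeasurableSet (D i) := fun i =>
    MeasurableSet.disjointed (fun i => (hUo (f i)).measurableSet) i
  have hDu : ⋃ i, s ∩ D i = s := by
    rw [← inter_iUnion, hD, iUnion_disjointed, hcov, inter_univ]
  have hdisj : Pairwise (Function.onFun Disjoint fun i => s ∩ D i) := fun i j hij =>
    (disjoint_disjointed _ hij).mono inter_subset_right inter_subset_right
  have key : ∀ ρ : Measure X, ρ s = ∑' i, ρ (s ∩ D i) := fun ρ => by
    conv_lhs => rw [← hDu]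
    exact measure_iUnion hdisj fun i => hs.inter (hDm i)
  rw [key μ, key ν, ← ENNReal.tsum_mul_left]
  exact ENNReal.tsum_le_tsum fun i =>
    h (f i) _ (hs.inter (hDm i)) (inter_subset_right.trans (disjointed_subset _ i))

section
variable {V : Type*} [NormedAddCommGroup V] [InnerProductSpace ℝ V]
variable [MeasurableSpace V] [BorelSpace V] [FiniteDimensional ℝ V]
open Module Filter Topology
open scoped Pointwise ENNReal NNReal

/-- The polar-coordinate measure on the unit sphere is the Hausdorff surface measure. In
dimension `0` the truncated `finrank ℝ V - 1` is harmless, the sphere being empty. -/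
theorem toSphere_eq_comap_euclideanHausdorffMeasure :
    (volume : Measure V).toSphere =
      (μHE[finrank ℝ V - 1] : Measure V).comap (Subtype.val : sphere (0 : V) 1 → V) := by
  have hemb : MeasurableEmbedding (Subtype.val : sphere (0 : V) 1 → V) :=
    MeasurableEmbedding.subtype_coe isClosed_sphere.measurableSet
  have hcap : ∀ ε : ℝ, ε < 1 → ∀ x : sphere (0 : V) 1, ∀ s : Set (sphere (0 : V) 1),
      MeasurableSet s → s ⊆ ball x ε → _ := fun ε hε x s hs hsx =>
    cap_comparison (v := (x : V)) (by simp) hε (hemb.measurableSet_image.2 hs)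
      (by rintro _ ⟨y, _, rfl⟩; simp)
      (by
        rintro _ ⟨y, hy, rfl⟩
        have := hsx hy
        rw [mem_ball, Subtype.dist_eq, dist_eq_norm] at this
        exact this.le)
  have hlim : ∀ g : ℝ → ℝ, ContinuousAt g 0 → g 0 = 1 → ∀ a : ℝ≥0∞,
      Tendsto (fun ε => ENNReal.ofReal (g ε) * a) (𝓝[>] 0) (𝓝 a) := by
    intro g hg h1 a
    have h2 : Tendsto (fun ε => ENNReal.ofReal (g ε)) (𝓝[>] 0) (𝓝 1) := by
      have := ENNReal.tendsto_ofReal (hg.tendsto.mono_left (nhdsWithin_le_nhds (s := Ioi 0)))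
      rwa [h1, ENNReal.ofReal_one] at this
    simpa using ENNReal.Tendsto.mul_const h2 (Or.inl one_ne_zero) (b := a)
  have hev : ∀ᶠ ε : ℝ in 𝓝[>] 0, 0 < ε ∧ ε < 1 :=
    Ioo_mem_nhdsGT zero_lt_one
  ext s hs
  refine le_antisymm ?_ ?_
  · refine ge_of_tendsto (hlim (fun ε => ((1 - ε) ^ 2)⁻¹ ^ (finrank ℝ V - 1)) ?_ (by simp) _) ?_
    · refine ContinuousAt.pow (ContinuousAt.inv₀ (by fun_prop) (by simp)) _
    · filter_upwards [hev] with ε hε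
      refine measure_le_mul_of_locally (fun x => ball x ε) (fun x => isOpen_ball)
        (fun x => mem_ball_self hε.1) (fun x t ht htx => ?_) hs
      rw [Measure.toSphere_apply' _ ht, hemb.comap_apply]
      exact (hcap ε hε.2 x t ht htx).2
  · refine ge_of_tendsto (hlim (fun ε => (1 - ε)⁻¹ ^ finrank ℝ V) ?_ (by simp) _) ?_
    · refine ContinuousAt.pow (ContinuousAt.inv₀ (by fun_prop) (by simp)) _
    · filter_upwards [hev] with ε hε
      refine measure_le_mul_of_locally (fun x => ball x ε) (fun x => isOpen_ball)
        (fun x => mem_ball_self hε.1) (fun x t ht htx => ?_) hs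
      rw [Measure.toSphere_apply' _ ht, hemb.comap_apply]
      exact (hcap ε hε.2 x t ht htx).1
end

/-! ### Polar coordinates -/

section
open Module Filter Topology
open scoped Pointwise ENNReal NNReal

variable {V : Type*} [NormedAddCommGroup V] [NormedSpace ℝ V]
variable [MeasurableSpace V] [BorelSpace V]

theorem integral_volumeIoiPow (d : ℕ) (g : ℝ → ℝ) :
    ∫ r : Ioi (0 : ℝ), g r ∂Measure.volumeIoiPow d = ∫ r in Ioi (0 : ℝ), r ^ d * g r := by
  simp only [Measure.volumeIoiPow, ENNReal.ofReal]
  rw [integral_withDensity_eq_integral_smul,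
    integral_subtype_comap measurableSet_Ioi fun a ↦ Real.toNNReal (a ^ d) • g a,
    setIntegral_congr_fun measurableSet_Ioi fun x hx ↦ ?_]
  · rw [NNReal.smul_def, Real.coe_toNNReal _ (pow_nonneg hx.out.le _), smul_eq_mul]
  · exact (measurable_subtype_coe.pow_const _).real_toNNReal

/-- Integration in polar coordinates. -/
theorem integral_polar [FiniteDimensional ℝ V] [Nontrivial V] (μ : Measure V) [μ.IsAddHaarMeasure] {f : V → ℝ} (hf : Integrable f μ) :
    Integrable (fun θ : sphere (0 : V) 1 =>
        ∫ r in Ioi (0 : ℝ), r ^ (finrank ℝ V - 1) * f (r • (θ : V))) μ.toSphere ∧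
      ∫ x, f x ∂μ = ∫ θ : sphere (0 : V) 1,
        (∫ r in Ioi (0 : ℝ), r ^ (finrank ℝ V - 1) * f (r • (θ : V))) ∂μ.toSphere := by
  have hmp := μ.measurePreserving_homeomorphUnitSphereProd
  have hemb := (homeomorphUnitSphereProd V).measurableEmbedding
  set g : sphere (0 : V) 1 × Ioi (0 : ℝ) → ℝ := fun p => f (p.2.1 • p.1.1) with hg
  have hgf : ∀ x : ({0}ᶜ : Set V), g (homeomorphUnitSphereProd V x) = f x := by
    intro x
    have hx : ‖(x : V)‖ ≠ 0 := norm_ne_zero_iff.2 x.2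
    simp only [hg, homeomorphUnitSphereProd_apply_snd_coe, homeomorphUnitSphereProd_apply_fst_coe]
    rw [smul_inv_smul₀ hx]
  have hgi : Integrable g (μ.toSphere.prod (Measure.volumeIoiPow (finrank ℝ V - 1))) := by
    rw [← hmp.integrable_comp_emb hemb]
    have h1 : Integrable (f ∘ ((↑) : ({0}ᶜ : Set V) → V)) (μ.comap (↑)) := by
      rw [← integrableOn_iff_comap_subtypeVal (measurableSet_singleton _).compl]
      exact hf.integrableOn
    exact h1.congr (Eventually.of_forall fun x => (hgf x).symm)
  have hin : ∀ θ : sphere (0 : V) 1,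
      ∫ r : Ioi (0 : ℝ), g (θ, r) ∂Measure.volumeIoiPow (finrank ℝ V - 1) =
        ∫ r in Ioi (0 : ℝ), r ^ (finrank ℝ V - 1) * f (r • (θ : V)) :=
    fun θ => integral_volumeIoiPow _ fun r => f (r • (θ : V))
  constructor
  · exact hgi.integral_prod_left.congr (Eventually.of_forall hin)
  · calc ∫ x, f x ∂μ = ∫ x : ({(0)}ᶜ : Set V), f x ∂(μ.comap (↑)) := by
          rw [integral_subtype_comap (measurableSet_singleton _).compl fun x ↦ f x,
            restrict_compl_singleton]
      _ = ∫ x : ({(0)}ᶜ : Set V), g (homeomorphUnitSphereProd V x) ∂(μ.comap (↑)) := by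
          simp_rw [hgf]
      _ = ∫ p, g p ∂(μ.toSphere.prod (Measure.volumeIoiPow (finrank ℝ V - 1))) :=
          hmp.integral_comp hemb g
      _ = _ := by
          rw [integral_prod _ hgi]
          simp_rw [hin]

/-- The density `r ↦ rⁿ⁻¹ 1_K(rθ)` of the volume of `K` along the ray through `θ`, with respect to
Lebesgue measure on `(0, ∞)`. Here `n` is the dimension of the space. -/
noncomputable def radialDensity (K : Set V) (θ : V) (r : ℝ) : ℝ :=
  r ^ (finrank ℝ V - 1) * K.indicator 1 (r • θ)

theorem radialDensity_measurable {K : Set V} (hK : MeasurableSet K) (θ : V) :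
    Measurable (radialDensity K θ) := by
  have h : Measurable fun r : ℝ => r • θ := by fun_prop
  exact (measurable_id.pow_const _).mul ((measurable_one.indicator hK).comp h)

omit [MeasurableSpace V] [BorelSpace V] in
theorem norm_radialDensity_le (K : Set V) (θ : V) {r R : ℝ} (h : |r| ≤ R) :
    ‖radialDensity K θ r‖ ≤ R ^ (finrank ℝ V - 1) := by
  rw [radialDensity, norm_mul, norm_pow, Real.norm_eq_abs]
  have h1 : ‖K.indicator (1 : V → ℝ) (r • θ)‖ ≤ 1 := by
    by_cases hr : r • θ ∈ K <;> simp [hr]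
  have hR : 0 ≤ R := (abs_nonneg r).trans h
  calc _ ≤ R ^ (finrank ℝ V - 1) * 1 := by gcongr
    _ = _ := mul_one _

theorem radialDensity_intervalIntegrable {K : Set V} (hK : MeasurableSet K) (θ : V) (a b : ℝ) :
    IntervalIntegrable (radialDensity K θ) volume a b := by
  refine (intervalIntegrable_const (c := (max |a| |b|) ^ (finrank ℝ V - 1))).mono_fun'
    (radialDensity_measurable hK θ).aestronglyMeasurable ?_
  filter_upwards [ae_restrict_mem measurableSet_uIoc] with r hr
  have hr' := uIoc_subset_uIcc hr
  refine norm_radialDensity_le K θ ?_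
  rcases le_total a b with h | h
  · rw [uIcc_of_le h] at hr'
    exact abs_le_max_abs_abs hr'.1 hr'.2
  · rw [uIcc_of_ge h] at hr'
    exact (abs_le_max_abs_abs hr'.1 hr'.2).trans_eq (max_comm _ _)

theorem abs_integral_radialDensity_sub_le {K : Set V} (hK : MeasurableSet K) (θ : V) {a b R : ℝ}
    (ha : |a| ≤ R) (hb : |b| ≤ R) :
    |(∫ r in 0..a, radialDensity K θ r) - ∫ r in 0..b, radialDensity K θ r| ≤
      R ^ (finrank ℝ V - 1) * |a - b| := by
  rw [intervalIntegral.integral_interval_sub_left (radialDensity_intervalIntegrable hK θ _ _)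
    (radialDensity_intervalIntegrable hK θ _ _)]
  rw [← Real.norm_eq_abs]
  refine intervalIntegral.norm_integral_le_of_norm_le_const fun r hr => ?_
  have hr' := uIoc_subset_uIcc hr
  refine norm_radialDensity_le K θ (abs_le.2 ?_)
  rw [abs_le] at ha hb
  exact ⟨(le_min hb.1 ha.1).trans hr'.1, hr'.2.trans (max_le hb.2 ha.2)⟩

theorem hasDerivAt_integral_radialDensity {K : Set V} (hK : MeasurableSet K) {θ : V}
    (hθ : θ ∉ frontier K) :
    HasDerivAt (fun u => ∫ r in 0..u, radialDensity K θ r) (K.indicator 1 θ) 1 := by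
  have hc : ContinuousAt (radialDensity K θ) 1 := by
    have h1 : ContinuousAt (K.indicator (1 : V → ℝ)) ((1 : ℝ) • θ) := by
      rw [one_smul]
      exact (continuousOn_const (c := (1 : ℝ))).continuousAt_indicator hθ
    have h2 : ContinuousAt (fun r : ℝ => r • θ) 1 := by fun_prop
    exact (continuousAt_id.pow _).mul (ContinuousAt.comp (f := fun r : ℝ => r • θ) h1 h2)
  have := intervalIntegral.integral_hasDerivAt_right (radialDensity_intervalIntegrable hK θ 0 1)
    ((radialDensity_measurable hK θ).stronglyMeasurable.stronglyMeasurableAtFilter) hc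
  simpa [radialDensity] using this

/-- Volume of `K ∩ M⁻¹ B` in polar coordinates, `B` being the closed unit ball: the radial function
of `M⁻¹ B` in the direction `θ` is `‖M θ‖⁻¹`. -/
theorem volume_inter_polar [FiniteDimensional ℝ V] [Nontrivial V] (μ : Measure V) [μ.IsAddHaarMeasure] {K : Set V}
    (hK : MeasurableSet K) (hKf : μ K ≠ ⊤) {M : V →L[ℝ] V} (hM : ∀ x, x ≠ 0 → M x ≠ 0) :
    Integrable (fun θ : sphere (0 : V) 1 =>
        ∫ r in (0 : ℝ)..‖M θ‖⁻¹, radialDensity K θ r) μ.toSphere ∧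
      (μ (K ∩ {x | ‖M x‖ ≤ 1})).toReal = ∫ θ : sphere (0 : V) 1,
        (∫ r in (0 : ℝ)..‖M θ‖⁻¹, radialDensity K θ r) ∂μ.toSphere := by
  set T := K ∩ {x | ‖M x‖ ≤ 1} with hT
  have hTm : MeasurableSet T :=
    hK.inter ((by fun_prop : Measurable fun x => ‖M x‖) measurableSet_Iic)
  have hTi : Integrable (T.indicator (1 : V → ℝ)) μ :=
    (integrable_indicator_iff hTm).2
      (integrableOn_const (measure_ne_top_of_subset inter_subset_left hKf))
  have hin : ∀ θ : sphere (0 : V) 1,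
      ∫ r in Ioi (0 : ℝ), r ^ (finrank ℝ V - 1) * T.indicator 1 (r • (θ : V)) =
        ∫ r in (0 : ℝ)..‖M θ‖⁻¹, radialDensity K θ r := by
    intro θ
    have h0 : 0 < ‖M θ‖ := norm_pos_iff.2 (hM _ (ne_zero_of_mem_unit_sphere θ))
    rw [intervalIntegral.integral_of_le (by positivity), ← Ioi_inter_Iic,
      ← setIntegral_indicator measurableSet_Iic]
    refine setIntegral_congr_fun measurableSet_Ioi fun r (hr : 0 < r) => ?_
    have hiff : r • (θ : V) ∈ T ↔ r • (θ : V) ∈ K ∧ r ∈ Iic ‖M θ‖⁻¹ := by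
      simp only [hT, mem_inter_iff, mem_ofPred_eq, mem_Iic, map_smul, norm_smul,
        Real.norm_of_nonneg hr.le, ← le_div_iff₀ h0, one_div]
    by_cases h1 : r • (θ : V) ∈ K <;> by_cases h2 : r ∈ Iic ‖M θ‖⁻¹ <;>
      simp [radialDensity, indicator, hiff, h1, h2]
  obtain ⟨h1, h2⟩ := integral_polar μ hTi
  simp_rw [hin] at h1 h2
  refine ⟨h1, ?_⟩
  rw [← h2, integral_indicator_one hTm, Measure.real]
end

/-! ### First variation of the volume -/

section
open Module Filter Topology
open scoped Pointwise ENNReal NNReal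

variable {V : Type*} [NormedAddCommGroup V] [InnerProductSpace ℝ V] [FiniteDimensional ℝ V]

theorem exp_neg_apply_exp_apply (M : V →L[ℝ] V) (x : V) :
    NormedSpace.exp (-M) (NormedSpace.exp M x) = x := by
  let _ : NormedAlgebra ℚ (V →L[ℝ] V) := NormedAlgebra.restrictScalars ℚ ℝ _
  have h := NormedSpace.exp_add_of_commute (Commute.neg_left (Commute.refl M))
  rw [neg_add_cancel, NormedSpace.exp_zero] at h
  exact (congrArg (fun N : V →L[ℝ] V => N x) h).symm

/-- First variation of the radial function of `e^{tB}` applied to the unit ball. -/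
theorem hasDerivAt_inv_norm_exp_smul (B : V →L[ℝ] V) {θ : V} (hθ : ‖θ‖ = 1) :
    HasDerivAt (fun t : ℝ => ‖NormedSpace.exp (t • (-B)) θ‖⁻¹) (inner ℝ θ (B θ)) 0 := by
  have h1 : HasDerivAt (fun t : ℝ => NormedSpace.exp (t • (-B)) θ) (-B θ) 0 := by
    have := (hasDerivAt_exp_smul_const (𝕂 := ℝ) (-B) (0 : ℝ)).clm_apply (hasDerivAt_const 0 θ)
    simpa using this
  have h2 : HasDerivAt (fun t : ℝ => ‖NormedSpace.exp (t • (-B)) θ‖) (-inner ℝ θ (B θ)) 0 := by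
    have h3 := h1.norm_sq.sqrt (by simp [hθ])
    simp only [Real.sqrt_sq (norm_nonneg _)] at h3
    convert! h3 using 1
    simp only [zero_smul, NormedSpace.exp_zero, one_apply_eq_self, hθ, inner_neg_right]
    ring
  have := h2.inv (by simp [hθ])
  convert! this using 1
  simp [hθ]

/-- Near `t = 0` the radial functions of `e^{tB}` applied to the unit ball are bounded and Lipschitz
in `t`, uniformly in the direction `θ`. -/
theorem exists_lipschitz_inv_norm_exp_smul (B : V →L[ℝ] V) :
    ∃ s ∈ 𝓝 (0 : ℝ), ∃ L : ℝ, ∀ t ∈ s, ∀ θ : V, ‖θ‖ = 1 →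
      ‖NormedSpace.exp (t • (-B)) θ‖⁻¹ ≤ 2 ∧ ∀ t' ∈ s,
      |‖NormedSpace.exp (t • (-B)) θ‖⁻¹ - ‖NormedSpace.exp (t' • (-B)) θ‖⁻¹| ≤ L * |t - t'| := by
  set E : ℝ → V →L[ℝ] V := fun t => NormedSpace.exp (t • (-B)) with hE
  obtain ⟨L, s, hs, hL⟩ :=
    (hasStrictDerivAt_exp_smul_const (𝕂 := ℝ) (-B) (0 : ℝ)).hasStrictFDerivAt.exists_lipschitzOnWith
  have hEc : ContinuousAt E 0 :=
    (hasDerivAt_exp_smul_const (𝕂 := ℝ) (-B) (0 : ℝ)).continuousAt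
  have hE0 : E 0 = 1 := by simp [hE]
  have hnear : ∀ᶠ t in 𝓝 (0 : ℝ), ‖E t - 1‖ < 1 / 2 := by
    have := hEc.eventually (ball_mem_nhds _ (by norm_num : (0 : ℝ) < 1 / 2))
    simpa [hE0, dist_eq_norm] using this
  have hlow : ∀ t, ‖E t - 1‖ < 1 / 2 → ∀ θ : V, ‖θ‖ = 1 → 1 / 2 ≤ ‖E t θ‖ := by
    intro t ht θ hθ
    have h1 : ‖(E t - 1) θ‖ ≤ ‖E t - 1‖ * ‖θ‖ := (E t - 1).le_opNorm θ
    have h2 : θ = E t θ - (E t - 1) θ := by simp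
    have h3 := norm_sub_le (E t θ) ((E t - 1) θ)
    rw [← h2, hθ] at h3
    rw [hθ] at h1
    linarith
  refine ⟨s ∩ {t | ‖E t - 1‖ < 1 / 2}, inter_mem hs hnear, 4 * L, ?_⟩
  rintro t ⟨hts, ht⟩ θ hθ
  have h1 := hlow t ht θ hθ
  refine ⟨?_, ?_⟩
  · calc _ ≤ (1 / 2 : ℝ)⁻¹ := inv_anti₀ (by norm_num) h1
      _ = 2 := by norm_num
  rintro t' ⟨hts', ht'⟩
  have h2 := hlow t' ht' θ hθ
  have h3 : |‖E t θ‖ - ‖E t' θ‖| ≤ L * |t - t'| := by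
    calc _ ≤ ‖E t θ - E t' θ‖ := abs_norm_sub_norm_le _ _
      _ = ‖(E t - E t') θ‖ := by simp
      _ ≤ ‖E t - E t'‖ * ‖θ‖ := (E t - E t').le_opNorm θ
      _ ≤ L * |t - t'| := by
        rw [hθ, mul_one]
        have h4 := hL.dist_le_mul t hts t' hts'
        rwa [dist_eq_norm, Real.dist_eq] at h4
  have ha : 0 < ‖E t θ‖ := by linarith
  have hb : 0 < ‖E t' θ‖ := by linarith
  rw [inv_sub_inv ha.ne' hb.ne', abs_div, abs_of_pos (mul_pos ha hb), abs_sub_comm,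
    div_le_iff₀ (mul_pos ha hb)]
  have hab : 1 ≤ 4 * (‖E t θ‖ * ‖E t' θ‖) := by nlinarith
  have h0 : 0 ≤ L * |t - t'| := by positivity
  nlinarith

variable [MeasurableSpace V] [BorelSpace V] [Nontrivial V]

/-- First variation of the volume of the intersection of `K` with the image of the unit ball under
`e^{tB}`. That almost no point of the sphere lies on the boundary of `K` makes the radial density
of `K` continuous at `r = 1` in almost every direction. -/
theorem hasDerivAt_volume_inter_exp_smul {K : Set V} (hK : MeasurableSet K)
    (hKf : volume K ≠ ⊤) (hfr : ∀ᵐ θ : sphere (0 : V) 1 ∂(volume : Measure V).toSphere,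
      (θ : V) ∉ frontier K) (B : V →L[ℝ] V) :
    Integrable (fun θ : sphere (0 : V) 1 => K.indicator (fun x => inner ℝ x (B x)) (θ : V))
      (volume : Measure V).toSphere ∧
    HasDerivAt (fun t : ℝ =>
        (volume (K ∩ {x | ‖NormedSpace.exp (t • (-B)) x‖ ≤ 1})).toReal)
      (∫ θ : sphere (0 : V) 1, K.indicator (fun x => inner ℝ x (B x)) (θ : V)
        ∂(volume : Measure V).toSphere) 0 := by
  obtain ⟨s, hs, L, hL⟩ := exists_lipschitz_inv_norm_exp_smul B
  have hne : ∀ t : ℝ, ∀ x : V, x ≠ 0 → NormedSpace.exp (t • (-B)) x ≠ 0 := by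
    intro t x hx h0
    rw [← exp_neg_apply_exp_apply (t • (-B)) x, h0, map_zero] at hx
    exact hx rfl
  have hpol := fun t : ℝ => volume_inter_polar volume hK hKf (hne t)
  simp_rw [fun t => (hpol t).2]
  refine hasDerivAt_integral_of_dominated_loc_of_lip
    (bound := fun _ => 2 ^ (finrank ℝ V - 1) * L) hs
    (Eventually.of_forall fun t => (hpol t).1.aestronglyMeasurable) (hpol 0).1 ?_ ?_
    (integrable_const _) ?_
  · have h1 : Measurable fun x : V => inner ℝ x (B x) := by fun_prop
    exact ((h1.indicator hK).comp measurable_subtype_coe).aestronglyMeasurable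
  · refine Eventually.of_forall fun θ => LipschitzOnWith.of_dist_le_mul fun t ht t' ht' => ?_
    have hθ : ‖(θ : V)‖ = 1 := norm_eq_of_mem_sphere θ
    have h1 := (hL t ht θ hθ).1
    have h2 := (hL t' ht' θ hθ).1
    rw [Real.dist_eq, Real.dist_eq, Real.coe_nnabs]
    refine (abs_integral_radialDensity_sub_le (R := 2) hK (θ : V)
      (by rwa [abs_of_nonneg (by positivity)]) (by rwa [abs_of_nonneg (by positivity)])).trans ?_
    calc _ ≤ 2 ^ (finrank ℝ V - 1) * (L * |t - t'|) := by
          exact mul_le_mul_of_nonneg_left ((hL t ht θ hθ).2 t' ht') (by positivity)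
      _ = 2 ^ (finrank ℝ V - 1) * L * |t - t'| := by ring
      _ ≤ _ := by 
          refine mul_le_mul_of_nonneg_right (le_abs_self _) (abs_nonneg _)
  · filter_upwards [hfr] with θ hθ
    have hθ1 : ‖(θ : V)‖ = 1 := norm_eq_of_mem_sphere θ
    have h1 := hasDerivAt_inv_norm_exp_smul B hθ1
    have h2 := (hasDerivAt_integral_radialDensity hK hθ)
    have h3 : ‖NormedSpace.exp ((0 : ℝ) • (-B)) (θ : V)‖⁻¹ = 1 := by simp
    convert! HasDerivAt.comp_of_eq 0 h2 h1 h3.symm using 1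
    by_cases h : (θ : V) ∈ K <;> simp [h]

end

/-! ### The sets `e^{tA} B` -/

section
open scoped Matrix.Norms.Operator

/-- The exponential depends only on the topology of matrices; the operator norm serves to make
`NormedSpace.map_exp` applicable. -/
theorem toEuclideanCLM_exp {n : ℕ} (A : Matrix (Fin n) (Fin n) ℝ) :
    Matrix.toEuclideanCLM (n := Fin n) (𝕜 := ℝ) (NormedSpace.exp A) =
      NormedSpace.exp (Matrix.toEuclideanCLM (n := Fin n) (𝕜 := ℝ) A) := by
  let _ : NormedAlgebra ℚ (Matrix (Fin n) (Fin n) ℝ) := NormedAlgebra.restrictScalars ℚ ℝ _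
  let _ : NormedAlgebra ℚ (EuclideanSpace ℝ (Fin n) →L[ℝ] EuclideanSpace ℝ (Fin n)) :=
    NormedAlgebra.restrictScalars ℚ ℝ _
  refine NormedSpace.map_exp (Matrix.toEuclideanCLM (n := Fin n) (𝕜 := ℝ)) ?_ A
  exact LinearMap.continuous_of_finiteDimensional
    (Matrix.toEuclideanCLM (n := Fin n) (𝕜 := ℝ)).toAlgEquiv.toLinearMap
end

/-- `e^{tA} B` as a sublevel set, the inverse of `e^{tA}` being `e^{-tA}`. -/
theorem expBall_eq {n : ℕ} (A : Matrix (Fin n) (Fin n) ℝ) (t : ℝ) :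
    expBall A t =
      {x | ‖NormedSpace.exp (t • (-Matrix.toEuclideanCLM (n := Fin n) (𝕜 := ℝ) A)) x‖ ≤ 1} := by
  set B := Matrix.toEuclideanCLM (n := Fin n) (𝕜 := ℝ) A with hB
  have h : ∀ x, Matrix.toEuclideanLin (NormedSpace.exp (t • A)) x = NormedSpace.exp (t • B) x := by
    intro x
    rw [hB, ← map_smul, ← toEuclideanCLM_exp]
    rfl
  have hset : expBall A t = (fun x => NormedSpace.exp (t • B) x) '' closedBall 0 1 :=
    image_congr fun x _ => h x
  rw [hset, smul_neg]
  ext y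
  constructor
  · rintro ⟨x, hx, rfl⟩
    rw [mem_ofPred_eq, exp_neg_apply_exp_apply]
    simpa using hx
  · intro hy
    refine ⟨NormedSpace.exp (-(t • B)) y, by simpa using hy, ?_⟩
    have := exp_neg_apply_exp_apply (-(t • B)) y
    rwa [neg_neg] at this

theorem theorem2p5 (n : ℕ) (K : ConvexBody (EuclideanSpace ℝ (Fin n)))
    (hK_int : (interior (K : Set (EuclideanSpace ℝ (Fin n)))).Nonempty)
    (hK_symm : ∀ x ∈ K, -x ∈ K)
    (hK_ell : {E : Set (EuclideanSpace ℝ (Fin n)) | IsEllipsoid E ∧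
      surfaceVolume n (frontier (K : Set (EuclideanSpace ℝ (Fin n))) ∩ frontier E) ≠ 0}.Finite)
    (hK_sphere : surfaceVolume n
      (frontier (K : Set (EuclideanSpace ℝ (Fin n))) ∩ sphere 0 1) = 0)
    (hK_pos : 0 < surfaceVolume n ((K : Set (EuclideanSpace ℝ (Fin n))) ∩ sphere 0 1))
    (hK_max : IsMaxIntersectionPosition (K : Set (EuclideanSpace ℝ (Fin n))) 1)
    (A : Matrix (Fin n) (Fin n) ℝ) (hA : A.trace = 0) :
    IntegrableOn (fun x => inner ℝ x (Matrix.toEuclideanLin A x))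
      (sphere 0 1 ∩ (K : Set (EuclideanSpace ℝ (Fin n)))) (surfaceVolume n) ∧
    HasDerivAt
      (fun t : ℝ => (volume ((K : Set (EuclideanSpace ℝ (Fin n))) ∩ expBall A t)).toReal)
      (∫ x in sphere 0 1 ∩ (K : Set (EuclideanSpace ℝ (Fin n))),
        inner ℝ x (Matrix.toEuclideanLin A x) ∂(surfaceVolume n)) 0 := by
  have hemb : MeasurableEmbedding (Subtype.val : sphere (0 : EuclideanSpace ℝ (Fin n)) 1 → _) :=
    MeasurableEmbedding.subtype_coe isClosed_sphere.measurableSet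
  -- In dimension `0` the sphere is empty, so `hK_pos` fails.
  have hn : n ≠ 0 := by
    rintro rfl
    have : sphere (0 : EuclideanSpace ℝ (Fin 0)) 1 = ∅ := sphere_eq_empty_of_subsingleton one_ne_zero
    simp [this] at hK_pos
  have : Nontrivial (EuclideanSpace ℝ (Fin n)) :=
    Module.nontrivial_of_finrank_pos (R := ℝ) (by simpa using Nat.pos_of_ne_zero hn)
  have hKm : MeasurableSet (K : Set (EuclideanSpace ℝ (Fin n))) := K.isCompact.measurableSet
  have hsph : (volume : Measure (EuclideanSpace ℝ (Fin n))).toSphere =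
      (surfaceVolume n).comap Subtype.val := by
    rw [toSphere_eq_comap_euclideanHausdorffMeasure, finrank_euclideanSpace_fin, surfaceVolume]
  have hfr : ∀ᵐ θ : sphere (0 : EuclideanSpace ℝ (Fin n)) 1 ∂(volume : Measure _).toSphere,
      (θ : EuclideanSpace ℝ (Fin n)) ∉ frontier (K : Set (EuclideanSpace ℝ (Fin n))) := by
    rw [hsph, ae_iff, hemb.comap_apply]
    refine measure_mono_null ?_ hK_sphere
    rintro _ ⟨θ, hθ, rfl⟩
    exact ⟨not_not.1 hθ, θ.2⟩
  obtain ⟨h1, h2⟩ := hasDerivAt_volume_inter_exp_smul hKm K.isCompact.measure_lt_top.ne hfr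
    (Matrix.toEuclideanCLM (n := Fin n) (𝕜 := ℝ) A)
  rw [hsph] at h1 h2
  simp_rw [expBall_eq]
  rw [integral_subtype_comap isClosed_sphere.measurableSet
    fun x => (K : Set (EuclideanSpace ℝ (Fin n))).indicator
      (fun x => inner ℝ x (Matrix.toEuclideanCLM (n := Fin n) (𝕜 := ℝ) A x)) x,
    setIntegral_indicator hKm] at h2
  refine ⟨?_, h2⟩
  have h3 := (integrableOn_iff_comap_subtypeVal
    (f := (K : Set (EuclideanSpace ℝ (Fin n))).indicator
      fun x => inner ℝ x (Matrix.toEuclideanCLM (n := Fin n) (𝕜 := ℝ) A x))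
    isClosed_sphere.measurableSet).2 h1
  rw [IntegrableOn, integrable_indicator_iff hKm, IntegrableOn,
    Measure.restrict_restrict hKm, inter_comm] at h3
  exact h3
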